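/- Let $M$ be a connected smooth manifold of finite dimension, possibly with boundary, with a symplectic form $\omega$, and let $f\colon M\to M$ be a smooth diffeomorphism with $f^*\omega=\omega$, together with a fixed smooth isotopy $(f_t)_{t\in[0,1]}$ of diffeomorphisms from $f_0=\mathrm{id}$ to $f_1=f$. For a smooth primitive $\beta$ of $\omega$ (i.e. $d\beta=\omega$), an action function of $f$ with respect to $\beta$ is a function $g\colon M\to\mathbb R$ with $dg=f^*\beta-\beta$, and the action of an $f$-invariant Borel probability measure $\mu$ is $\mathcal A(\mu)=\int_M g\,d\mu$. A class $\rho(\mu)\in H_1(M,\mathbb R)$ is the rotation vector of $\mu$ (with respect to the isotopy) if for every closed smooth $1$-form $\alpha$ the function $x\mapsto\int_{\gamma(\cdot,x)}\alpha$, with $\gamma(t,x)=f_t(x)$, $t\in[0,1]$, is $\mu$-integrable and $$\langle\rho(\mu),[\alpha]\rangle=\int_M\Big(\int_{\gamma(\cdot,x)}\alpha\Big)\,d\mu(x),$$ where $\langle\cdot,\cdot\rangle$ is the canonical pairing between $H_1(M,\mathbb R)$ and $H^1(M,\mathbb R)$. Let $\mu_1,\mu_2$ be $f$-invariant Borel probability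 measures that have rotation vectors $\rho(\mu_1),\rho(\mu_2)$. Let $\beta$ and $\tilde\beta=\beta+\alpha$ be smooth primitives of $\omega$ (so that $\alpha$ is closed), let $g$ and $\tilde g$ be any action functions of $f$ with respect to $\beta$ and $\tilde\beta$, and let $\mathcal A$ and $\widetilde{\mathcal A}$ be the actions they define. If $g$ is integrable with respect to $\mu_1$ and $\mu_2$, then so is $\tilde g$, and $$\widetilde{\mathcal A}(\mu_1)-\widetilde{\mathcal A}(\mu_2)=\mathcal A(\mu_1)-\mathcal A(\mu_2)+\langle\rho(\mu_1)-\rho(\mu_2),[\alpha]\rangle .$$ In particular, if $\rho(\mu_1)=\rho(\mu_2)$, then $\widetilde{\mathcal A}(\mu_1)-\widetilde{\mathcal A}(\mu_2)=\mathcal A(\mu_1)-\mathcal A(\mu_2)$; that is, the action difference depends neither on the choice of the primitive of $\omega$ nor on the integration constant of the action function. -/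

import Mathlib

open Set Filter Topology MeasureTheory
open scoped Manifold ContDiff

universe u

noncomputable section

namespace ExactSymplectic

variable {E : Type*} [NormedAddCommGroup E] [NormedSpace ℝ E]
  {H : Type*} [TopologicalSpace H] (I : ModelWithCorners ℝ E H)
  (M : Type u) [TopologicalSpace M] [ChartedSpace H M]

/-- Differential `k`-forms on `M` (no regularity). -/
def DiffForm (k : ℕ) : Type _ := ∀ x : M, TangentSpace I x [⋀^Fin k]→L[ℝ] ℝ

instance (k : ℕ) : AddCommGroup (DiffForm I M k) :=
  inferInstanceAs (AddCommGroup (∀ x : M, TangentSpace I x [⋀^Fin k]→L[ℝ] ℝ))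

instance (k : ℕ) : Module ℝ (DiffForm I M k) :=
  inferInstanceAs (Module ℝ (∀ x : M, TangentSpace I x [⋀^Fin k]→L[ℝ] ℝ))

variable {I M}

/-- The expression of `η` in the chart at `x₀`, i.e. the pullback of `η` under the inverse chart. -/
def chartRep {k : ℕ} (η : DiffForm I M k) (x₀ : M) (y : E) : E [⋀^Fin k]→L[ℝ] ℝ :=
  (η ((extChartAt I x₀).symm y)).compContinuousLinearMap
    (mfderivWithin 𝓘(ℝ, E) I (extChartAt I x₀).symm (range I) y)

/-- `η` is `C^∞`: its expression in every chart is `C^∞` (up to the boundary). -/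
def IsSmoothForm {k : ℕ} (η : DiffForm I M k) : Prop :=
  ∀ x₀ : M, ContDiffOn ℝ ∞ (chartRep η x₀) (extChartAt I x₀).target

/-- `dη = θ`. -/
def HasExtDeriv {k : ℕ} (η : DiffForm I M k) (θ : DiffForm I M (k + 1)) : Prop :=
  ∀ x₀ : M, ∀ y ∈ (extChartAt I x₀).target,
    extDerivWithin (chartRep η x₀) (range I) y = chartRep θ x₀ y

/-- The linear functional on `T_x M` given by a `1`-form. -/
def DiffForm.toDual (α : DiffForm I M 1) (x : M) : TangentSpace I x →L[ℝ] ℝ :=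
  (ContinuousAlternatingMap.ofSubsingleton ℝ (TangentSpace I x) ℝ (0 : Fin 1)).symm (α x)

lemma DiffForm.toDual_apply (α : DiffForm I M 1) (x : M) (v : TangentSpace I x) :
    α.toDual x v = α x ![v] := by
  simp only [DiffForm.toDual]
  have : (![v] : Fin 1 → TangentSpace I x) = fun _ => v := by ext i; fin_cases i; rfl
  rw [this]; rfl

/-- `dS = α` for a function `S` and a `1`-form `α`. -/
def HasDifferential (S : M → ℝ) (α : DiffForm I M 1) : Prop :=
  ∀ x : M, HasMFDerivAt I 𝓘(ℝ, ℝ) S x (α.toDual x)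

lemma toDual_add (α β : DiffForm I M 1) (x : M) : (α + β).toDual x = α.toDual x + β.toDual x := rfl

lemma toDual_smul (c : ℝ) (α : DiffForm I M 1) (x : M) : (c • α).toDual x = c • α.toDual x := rfl

lemma toDual_zero (x : M) : (0 : DiffForm I M 1).toDual x = 0 := rfl

lemma chartRep_add {k : ℕ} (η θ : DiffForm I M k) (x₀ : M) :
    chartRep (η + θ) x₀ = chartRep η x₀ + chartRep θ x₀ := by
  ext y v; simp [chartRep]; rfl

lemma chartRep_smul {k : ℕ} (c : ℝ) (η : DiffForm I M k) (x₀ : M) :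
    chartRep (c • η) x₀ = c • chartRep η x₀ := by
  ext y v; simp [chartRep]; rfl

lemma chartRep_zero {k : ℕ} (x₀ : M) :
    chartRep (0 : DiffForm I M k) x₀ = 0 := by
  ext y v; simp [chartRep]; rfl

lemma IsSmoothForm.add {k : ℕ} {η θ : DiffForm I M k} (h : IsSmoothForm η) (h' : IsSmoothForm θ) :
    IsSmoothForm (η + θ) := fun x₀ => by
  rw [chartRep_add]; exact (h x₀).add (h' x₀)

lemma IsSmoothForm.smul {k : ℕ} {η : DiffForm I M k} (c : ℝ) (h : IsSmoothForm η) :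
    IsSmoothForm (c • η) := fun x₀ => by
  rw [chartRep_smul]; exact contDiffOn_const.smul (h x₀)

lemma IsSmoothForm.differentiableWithinAt {k : ℕ} {η : DiffForm I M k} (h : IsSmoothForm η)
    (x₀ : M) {y : E} (hy : y ∈ (extChartAt I x₀).target) :
    DifferentiableWithinAt ℝ (chartRep η x₀) (range I) y :=
  (((h x₀) y hy).differentiableWithinAt (by simp)).mono_of_mem_nhdsWithin
    (extChartAt_target_mem_nhdsWithin_of_mem hy)

lemma HasExtDeriv.add {k : ℕ} {η θ : DiffForm I M k} {dη dθ : DiffForm I M (k + 1)}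
    (h : HasExtDeriv η dη) (h' : HasExtDeriv θ dθ) (s : IsSmoothForm η) (s' : IsSmoothForm θ) :
    HasExtDeriv (η + θ) (dη + dθ) := fun x₀ y hy => by
  rw [chartRep_add, chartRep_add, extDerivWithin_add
    (I.uniqueDiffOn _ (extChartAt_target_subset_range x₀ hy)) (s.differentiableWithinAt x₀ hy)
    (s'.differentiableWithinAt x₀ hy), h x₀ y hy, h' x₀ y hy]; rfl

lemma HasExtDeriv.smul {k : ℕ} {η : DiffForm I M k} {dη : DiffForm I M (k + 1)} (c : ℝ)
    (h : HasExtDeriv η dη) : HasExtDeriv (c • η) (c • dη) := fun x₀ y hy => by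
  rw [chartRep_smul, chartRep_smul, extDerivWithin_smul _ _
    (I.uniqueDiffOn _ (extChartAt_target_subset_range x₀ hy)), h x₀ y hy]; rfl

variable (I M) in
/-- The space of closed (`C^∞`) `k`-forms. -/
def closedForms (k : ℕ) : Submodule ℝ (DiffForm I M k) where
  carrier := {η | IsSmoothForm η ∧ HasExtDeriv η 0}
  add_mem' := fun {a b} ha hb =>
    ⟨ha.1.add hb.1, by simpa using ha.2.add hb.2 ha.1 hb.1⟩
  zero_mem' := by
    refine ⟨fun x₀ => by rw [chartRep_zero]; exact contDiffOn_const, fun x₀ y _ => ?_⟩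
    simpa [chartRep_zero] using extDerivWithin_smul (𝕜 := ℝ) (0 : ℝ)
      (0 : E → E [⋀^Fin k]→L[ℝ] ℝ) (s := range I) (x := y)
      (I.uniqueDiffOn _ (extChartAt_target_subset_range x₀ ‹_›))
  smul_mem' := fun c a ha => ⟨ha.1.smul c, by simpa using ha.2.smul c⟩

variable (I M) in
/-- The space of exact `1`-forms, as a subspace of the closed ones. A function `S` with `dS = α`
and `α` of class `C^∞` is itself `C^∞`. -/
def exactForms : Submodule ℝ (closedForms I M 1) where
  carrier := {α | ∃ S : M → ℝ, HasDifferential S α.1}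
  add_mem' := by
    rintro a b ⟨S, hS⟩ ⟨T, hT⟩
    exact ⟨S + T, fun x => (hS x).add (hT x)⟩
  zero_mem' := ⟨fun _ => 0, fun x => hasMFDerivAt_const (I := I) (I' := 𝓘(ℝ, ℝ)) (0 : ℝ) x⟩
  smul_mem' := by
    rintro c a ⟨S, hS⟩
    exact ⟨c • S, fun x => (hS x).const_smul c⟩

variable (I M) in
/-- The first de Rham cohomology `H¹(M, ℝ)`. -/
abbrev deRhamH1 : Type _ := closedForms I M 1 ⧸ exactForms I M

/-! ### Local primitives -/

/-- A small convex neighbourhood in a chart. -/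
lemma exists_convex_chart_nhds (x : M) {U : Set M} (hU : U ∈ 𝓝 x) :
    ∃ s : Set E, Convex ℝ s ∧ UniqueDiffOn ℝ s ∧ s ⊆ (extChartAt I x).target ∧
      extChartAt I x x ∈ s ∧ (∀ y ∈ s, s ∈ 𝓝[range I] y) ∧
      (∀ y ∈ s, (extChartAt I x).symm y ∈ U) := by
  have h1 : (extChartAt I x).target ∩ (extChartAt I x).symm ⁻¹' U ∈
      𝓝[range I] (extChartAt I x x) :=
    inter_mem (extChartAt_target_mem_nhdsWithin x) (by
      have := (continuousAt_extChartAt_symm (I := I) x).preimage_mem_nhds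
        (t := U) (by simpa using hU)
      exact mem_nhdsWithin_of_mem_nhds this)
  obtain ⟨r, hr, hsub⟩ := Metric.mem_nhdsWithin_iff.1 h1
  refine ⟨Metric.ball (extChartAt I x x) r ∩ range I, (convex_ball _ _).inter I.convex_range, ?_,
    fun y hy => (hsub hy).1, ⟨Metric.mem_ball_self hr, mem_range_self _⟩, fun y hy => ?_,
    fun y hy => (hsub hy).2⟩
  · rw [inter_comm]; exact I.uniqueDiffOn.inter Metric.isOpen_ball
  · exact inter_mem (mem_nhdsWithin_of_mem_nhds (Metric.isOpen_ball.mem_nhds hy.1))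
      self_mem_nhdsWithin

/-- Pulling a convex chart neighbourhood back to the manifold. -/
lemma eventually_mem_of_chart (x : M) {s : Set E} (hx : extChartAt I x x ∈ s)
    (hs : ∀ y ∈ s, s ∈ 𝓝[range I] y) :
    ∀ᶠ y in 𝓝 x, y ∈ (extChartAt I x).source ∧ extChartAt I x y ∈ s := by
  refine Eventually.and (extChartAt_source_mem_nhds (I := I) x) ?_
  have h := (continuousAt_extChartAt (I := I) x)
  have h2 : Tendsto (extChartAt I x) (𝓝 x) (𝓝[range I] (extChartAt I x x)) :=
    tendsto_nhdsWithin_iff.2 ⟨h, Eventually.of_forall fun y => by simp [extChartAt]⟩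
  exact h2 (hs _ hx)

/-- Two functions with the same differential near `x` differ by a constant near `x`. -/
lemma eventually_sub_eq_of_hasMFDerivAt [IsManifold I ∞ M] {α : DiffForm I M 1} {S T : M → ℝ}
    {x : M} (hS : ∀ᶠ y in 𝓝 x, HasMFDerivAt I 𝓘(ℝ, ℝ) S y (α.toDual y))
    (hT : ∀ᶠ y in 𝓝 x, HasMFDerivAt I 𝓘(ℝ, ℝ) T y (α.toDual y)) :
    ∀ᶠ y in 𝓝 x, S y - T y = S x - T x := by
  have : IsManifold I 1 M := IsManifold.of_le (n := ∞) (by simp)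
  obtain ⟨s, hconv, hud, hst, hxs, hnhds, hsU⟩ := exists_convex_chart_nhds (I := I) x (hS.and hT)
  have key : ∀ y ∈ s, HasFDerivWithinAt
      (fun z => S ((extChartAt I x).symm z) - T ((extChartAt I x).symm z)) (0 : E →L[ℝ] ℝ) s y := by
    intro y hy
    obtain ⟨h1, h2⟩ := hsU y hy
    have h3 := (mdifferentiableWithinAt_extChartAt_symm (I := I) (hst hy)).hasMFDerivWithinAt
    have h4 := (h1.comp_hasMFDerivWithinAt y h3)
    have h5 := (h2.comp_hasMFDerivWithinAt y h3)
    have h6 := ((hasMFDerivWithinAt_iff_hasFDerivWithinAt.1 h4).sub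
      (hasMFDerivWithinAt_iff_hasFDerivWithinAt.1 h5)).mono
      (hst.trans (extChartAt_target_subset_range x))
    convert! h6 using 1
    exact (sub_self _).symm
  filter_upwards [eventually_mem_of_chart (I := I) x hxs hnhds] with y hy
  have := hconv.is_const_of_fderivWithin_eq_zero (𝕜 := ℝ)
    (fun z hz => (key z hz).differentiableWithinAt)
    (fun z hz => (key z hz).fderivWithin (hud z hz)) hy.2 hxs
  simpa only [(extChartAt I x).left_inv hy.1, extChartAt_to_inv] using this

lemma toDual_congr (α : DiffForm I M 1) {z y : M} (h : z = y) (w : E) :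
    α.toDual z (w : TangentSpace I z) = α.toDual y (w : TangentSpace I y) := by
  subst h; rfl

/-- A closed `1`-form has a primitive near every point. -/
lemma exists_local_primitive [IsManifold I ∞ M] {α : DiffForm I M 1}
    (hα : α ∈ closedForms I M 1) (x : M) :
    ∃ S : M → ℝ, ∀ᶠ y in 𝓝 x, HasMFDerivAt I 𝓘(ℝ, ℝ) S y (α.toDual y) := by
  have : IsManifold I 1 M := IsManifold.of_le (n := ∞) (by simp)
  obtain ⟨s, hconv, hud, hst, hxs, hnhds, -⟩ :=
    exists_convex_chart_nhds (I := I) x (U := univ) univ_mem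
  obtain ⟨hsm, hcl⟩ := hα
  set L := (ContinuousAlternatingMap.ofSubsingletonLIE (𝕜 := ℝ) (E := E) (F := ℝ) (0 : Fin 1)).symm with hL
  have hd : ∀ y ∈ s, HasFDerivWithinAt (fun z => L (chartRep α x z))
      ((L : (E [⋀^Fin 1]→L[ℝ] ℝ) →L[ℝ] (E →L[ℝ] ℝ)).comp
        (fderivWithin ℝ (chartRep α x) (range I) y)) s y := fun y hy =>
    (L : (E [⋀^Fin 1]→L[ℝ] ℝ) →L[ℝ] (E →L[ℝ] ℝ)).hasFDerivAt.comp_hasFDerivWithinAt y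
      ((hsm.differentiableWithinAt x (hst hy)).hasFDerivWithinAt.mono
        (hst.trans (extChartAt_target_subset_range x)))
  obtain ⟨f, hf⟩ := hconv.exists_forall_hasFDerivWithinAt_of_hasFDerivWithinAt_symmetric hd (by
    intro a ha u _ v _
    have h1 := hcl x a (hst ha)
    rw [chartRep_zero] at h1
    have h2 := congrArg (fun w : E [⋀^Fin 2]→L[ℝ] ℝ => w ![u, v]) h1
    have e : extDerivWithin (chartRep α x) (range I) a ![u, v] =
        ∑ i : Fin 2, (-1) ^ (i : ℕ) • fderivWithin ℝ (chartRep α x) (range I) a (![u, v] i)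
          (Fin.removeNth i ![u, v]) :=
      ContinuousAlternatingMap.alternatizeUncurryFin_apply _ _
    rw [Fin.sum_univ_two] at e
    have e0 : Fin.removeNth 0 ![u, v] = fun _ : Fin 1 => v := by
      ext i; fin_cases i; rfl
    have e1 : Fin.removeNth 1 ![u, v] = fun _ : Fin 1 => u := by
      ext i; fin_cases i; rfl
    rw [e0, e1] at e
    have h3 : fderivWithin ℝ (chartRep α x) (range I) a u (fun _ : Fin 1 => v) =
        fderivWithin ℝ (chartRep α x) (range I) a v (fun _ : Fin 1 => u) := by
      have h4 := e.symm.trans h2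
      simp at h4
      linarith
    exact h3)
  refine ⟨fun y => f (extChartAt I x y), ?_⟩
  have hnear := (eventually_mem_of_chart (I := I) x hxs hnhds).eventually_nhds
  filter_upwards [hnear] with y hy
  have hy0 := hy.self_of_nhds
  have hsrc : y ∈ (chartAt H x).source := by simpa [extChartAt_source] using hy0.1
  have h1 := (mdifferentiableAt_extChartAt (I := I) hsrc).hasMFDerivAt
  have h2 := (hf _ hy0.2).hasMFDerivWithinAt
  have h3 := h2.comp y (h1.hasMFDerivWithinAt (s := (extChartAt I x) ⁻¹' s))
    (fun z hz => hz)
  have h4 := h3.hasMFDerivAt (hy.mono fun z hz => hz.2)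
  have h5 := mfderivWithin_extChartAt_symm_comp_mfderiv_extChartAt' (I := I) hy0.1
  have h7 : ∀ v : E, (α.toDual y : E →L[ℝ] ℝ) v =
      (L (chartRep α x (extChartAt I x y))) (mfderiv I 𝓘(ℝ, E) (extChartAt I x) y v) := by
    intro v
    have h6 : mfderivWithin 𝓘(ℝ, E) I (extChartAt I x).symm (range I) (extChartAt I x y)
      (mfderiv I 𝓘(ℝ, E) (extChartAt I x) y v) = v := congrArg (fun A : E →L[ℝ] E => A v) h5
    have h8 := toDual_congr α ((extChartAt I x).left_inv hy0.1)
      (mfderivWithin 𝓘(ℝ, E) I (extChartAt I x).symm (range I) (extChartAt I x y)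
        (mfderiv I 𝓘(ℝ, E) (extChartAt I x) y v))
    refine Eq.trans ?_ (h8.symm.trans ?_)
    · exact congrArg (α.toDual y : E →L[ℝ] ℝ) h6.symm
    · rfl
  have h9 : (α.toDual y : E →L[ℝ] ℝ) = (L (chartRep α x (extChartAt I x y))).comp
      (mfderiv I 𝓘(ℝ, E) (extChartAt I x) y : E →L[ℝ] E) :=
    ContinuousLinearMap.ext h7
  exact Eq.mpr (congrArg (fun A : E →L[ℝ] ℝ =>
    HasMFDerivAt I 𝓘(ℝ, ℝ) (fun y => f (extChartAt I x y)) y A) h9) h4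


/-- On a simply connected, locally path connected space, functions given locally up to additive
constants can be glued up to additive constants. -/
lemma exists_glued {X : Type*} [TopologicalSpace X] [SimplyConnectedSpace X]
    [LocallyPathConnectedSpace X] (U : X → Set X) (hUo : ∀ i, IsOpen (U i)) (hU : ∀ i, i ∈ U i)
    (S : X → X → ℝ)
    (hS : ∀ i j, ∀ x ∈ U i ∩ U j, ∀ᶠ y in 𝓝 x, S i y - S j y = S i x - S j x) :
    ∃ F : X → ℝ, ∀ i, ∀ x ∈ U i, ∀ᶠ y in 𝓝 x, F y - S i y = F x - S i x := by
  let D := {r : ℝ // True}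
  let tD : TopologicalSpace D := ⊥
  have dD : DiscreteTopology D := ⟨rfl⟩
  let Z : FiberBundleCore X X D :=
    { baseSet := U
      isOpen_baseSet := hUo
      indexAt := id
      mem_baseSet_at := hU
      coordChange := fun i j x r => ⟨r.1 + (S i x - S j x), trivial⟩
      coordChange_self := fun i x _ r => by ext; simp
      coordChange_comp := fun i j k x _ r => by ext; simp; ring
      continuousOn_coordChange := by
        intro i j
        rintro ⟨x, r⟩ ⟨hx, -⟩
        refine ContinuousAt.continuousWithinAt ?_
        have h1 : ∀ᶠ p : X × D in 𝓝 (x, r), p.2 = r ∧ S i p.1 - S j p.1 = S i x - S j x := by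
          refine Filter.Eventually.and ?_ ?_
          · exact (continuous_snd.tendsto (x, r)).eventually
              (show ∀ᶠ z in 𝓝 r, z = r by simp)
          · exact (continuous_fst.tendsto (x, r)).eventually (hS i j x hx)
        refine ContinuousAt.congr_of_eventuallyEq (f := fun p : X × D => (⟨r.1 + (S i x - S j x), trivial⟩ : D)) continuousAt_const ?_
        filter_upwards [h1] with p hp
        ext; simp [hp.1, hp.2] }
  have cov : IsCoveringMap (Bundle.TotalSpace.proj : Bundle.TotalSpace D Z.Fiber → X) :=
    FiberBundle.isCoveringMap
  obtain ⟨x₀⟩ : Nonempty X := inferInstance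
  obtain ⟨s, ⟨-, hs⟩, -⟩ := cov.existsUnique_continuousMap_lifts (ContinuousMap.id X) x₀
    (⟨x₀, (⟨0, trivial⟩ : D)⟩ : Bundle.TotalSpace D Z.Fiber) rfl
  have hs' : ∀ x, (s x).proj = x := fun x => congrFun hs x
  refine ⟨fun x => ((s x).2 : D).1 + S (s x).proj x, fun i x hx => ?_⟩
  have h1 : ContinuousAt (fun y => (Z.localTriv i (s y)).2) x :=
    continuousAt_snd.comp (((Z.localTriv i).continuousOn_toFun.continuousAt
      ((Z.localTriv i).open_source.mem_nhds (by
        rw [(Z.localTriv i).source_eq]; show (s x).proj ∈ U i; rw [hs']; exact hx))).comp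
      s.continuous.continuousAt)
  have h2 : ∀ᶠ y in 𝓝 x, (Z.localTriv i (s y)).2 = (Z.localTriv i (s x)).2 :=
    h1.eventually (show ∀ᶠ z in 𝓝 (Z.localTriv i (s x)).2, z = _ by simp)
  filter_upwards [h2] with y hy
  have h3 : ∀ y, ((Z.localTriv i (s y)).2 : D).1 =
      ((s y).2 : D).1 + (S (s y).proj (s y).proj - S i (s y).proj) := fun y => rfl
  have h4 := congrArg Subtype.val hy
  rw [h3, h3] at h4
  simp only [hs'] at h4 ⊢
  linarith

instance simplyConnectedSpace_stdSimplex {ι : Type*} [Fintype ι] [Nonempty ι] : SimplyConnectedSpace (stdSimplex ℝ ι) := by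
  classical
  have := (convex_stdSimplex ℝ ι).contractibleSpace
    ⟨_, single_mem_stdSimplex ℝ (Classical.arbitrary ι)⟩
  infer_instance

instance locallyPathConnectedSpace_stdSimplex {ι : Type*} [Fintype ι] : LocallyPathConnectedSpace (stdSimplex ℝ ι) :=
  (convex_stdSimplex ℝ ι).locallyPathConnectedSpace

/-! ### Integration of closed `1`-forms over continuous paths -/

/-- `F` is a primitive of `α` along `σ`: near every point of `X` it is `S ∘ σ` (up to an additive
constant) for a local primitive `S` of `α`. -/
def IsPrimitiveAlong {X : Type*} [TopologicalSpace X] (α : DiffForm I M 1) (σ : X → M)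
    (F : X → ℝ) : Prop :=
  ∀ x : X, ∃ S : M → ℝ, (∀ᶠ y in 𝓝 (σ x), HasMFDerivAt I 𝓘(ℝ, ℝ) S y (α.toDual y)) ∧
    ∀ᶠ x' in 𝓝 x, F x' - S (σ x') = F x - S (σ x)

lemma IsPrimitiveAlong.comp {X Y : Type*} [TopologicalSpace X] [TopologicalSpace Y]
    {α : DiffForm I M 1} {σ : X → M} {F : X → ℝ} (h : IsPrimitiveAlong α σ F) {τ : Y → X}
    (hτ : Continuous τ) : IsPrimitiveAlong α (σ ∘ τ) (F ∘ τ) := fun y => by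
  obtain ⟨S, h1, h2⟩ := h (τ y)
  exact ⟨S, h1, (hτ.tendsto y).eventually h2⟩

/-- Primitives along a map are unique up to an additive constant. -/
lemma IsPrimitiveAlong.sub_eq [IsManifold I ∞ M] {X : Type*} [TopologicalSpace X]
    [PreconnectedSpace X] {α : DiffForm I M 1} {σ : X → M} (hσ : Continuous σ) {F G : X → ℝ}
    (hF : IsPrimitiveAlong α σ F) (hG : IsPrimitiveAlong α σ G) (x y : X) :
    F x - F y = G x - G y := by
  have h : IsLocallyConstant (fun z => F z - G z) := by
    refine (IsLocallyConstant.iff_eventually_eq _).2 fun z => ?_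
    obtain ⟨S, h1, h2⟩ := hF z
    obtain ⟨T, h3, h4⟩ := hG z
    filter_upwards [h2, h4, (hσ.tendsto z).eventually (eventually_sub_eq_of_hasMFDerivAt h1 h3)]
      with w a b c
    linarith
  have := h.apply_eq_of_preconnectedSpace x y
  linarith

lemma exists_isPrimitiveAlong [IsManifold I ∞ M] {X : Type*} [TopologicalSpace X]
    [SimplyConnectedSpace X] [LocallyPathConnectedSpace X] (α : closedForms I M 1) (σ : C(X, M)) :
    ∃ F : X → ℝ, IsPrimitiveAlong α.1 σ F := by
  choose S hS using fun x => exists_local_primitive α.2 (σ x)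
  choose V hV hVo hVm using fun x => eventually_nhds_iff.1 (hS x)
  obtain ⟨F, hF⟩ := exists_glued (fun x => σ ⁻¹' (V x)) (fun x => (hVo x).preimage σ.continuous)
    (fun x => hVm x) (fun x y => S x (σ y)) (fun i j x hx =>
      (σ.continuous.tendsto x).eventually (eventually_sub_eq_of_hasMFDerivAt
        (eventually_of_mem ((hVo i).mem_nhds hx.1) (hV i))
        (eventually_of_mem ((hVo j).mem_nhds hx.2) (hV j))))
  exact ⟨F, fun x => ⟨S x, hS x, hF x x (hVm x)⟩⟩

/-- The integral of a closed `1`-form `α` over a continuous path `σ : Δ¹ → M`: the increment of a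
primitive of `α` along `σ`. -/
def simplexIntegral [IsManifold I ∞ M] (α : closedForms I M 1) (σ : C(stdSimplex ℝ (Fin 2), M)) :
    ℝ :=
  (exists_isPrimitiveAlong α σ).choose (stdSimplex.vertex 1) -
    (exists_isPrimitiveAlong α σ).choose (stdSimplex.vertex 0)

lemma simplexIntegral_eq [IsManifold I ∞ M] {α : closedForms I M 1}
    {σ : C(stdSimplex ℝ (Fin 2), M)} {F : stdSimplex ℝ (Fin 2) → ℝ}
    (hF : IsPrimitiveAlong α.1 σ F) :
    simplexIntegral α σ = F (stdSimplex.vertex 1) - F (stdSimplex.vertex 0) :=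
  IsPrimitiveAlong.sub_eq σ.continuous (exists_isPrimitiveAlong α σ).choose_spec hF _ _

lemma simplexIntegral_add [IsManifold I ∞ M] (α β : closedForms I M 1)
    (σ : C(stdSimplex ℝ (Fin 2), M)) :
    simplexIntegral (α + β) σ = simplexIntegral α σ + simplexIntegral β σ := by
  obtain ⟨F, hF⟩ := exists_isPrimitiveAlong α σ
  obtain ⟨G, hG⟩ := exists_isPrimitiveAlong β σ
  have h : IsPrimitiveAlong (α + β).1 σ (F + G) := fun x => by
    obtain ⟨S, h1, h2⟩ := hF x
    obtain ⟨T, h3, h4⟩ := hG x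
    refine ⟨S + T, ?_, ?_⟩
    · filter_upwards [h1, h3] with y a b using a.add b
    · filter_upwards [h2, h4] with y a b
      simp only [Pi.add_apply]; linarith
  rw [simplexIntegral_eq hF, simplexIntegral_eq hG, simplexIntegral_eq h]
  simp only [Pi.add_apply]; ring

lemma simplexIntegral_smul [IsManifold I ∞ M] (c : ℝ) (α : closedForms I M 1)
    (σ : C(stdSimplex ℝ (Fin 2), M)) :
    simplexIntegral (c • α) σ = c * simplexIntegral α σ := by
  obtain ⟨F, hF⟩ := exists_isPrimitiveAlong α σ
  have h : IsPrimitiveAlong (c • α).1 σ (c • F) := fun x => by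
    obtain ⟨S, h1, h2⟩ := hF x
    refine ⟨c • S, ?_, ?_⟩
    · filter_upwards [h1] with y a using a.const_smul c
    · filter_upwards [h2] with y a
      simp only [Pi.smul_apply, smul_eq_mul, ← mul_sub, a]
  rw [simplexIntegral_eq hF, simplexIntegral_eq h]
  simp only [Pi.smul_apply, smul_eq_mul]; ring

lemma simplexIntegral_exact [IsManifold I ∞ M] {α : closedForms I M 1} {S : M → ℝ}
    (hS : HasDifferential S α.1) (σ : C(stdSimplex ℝ (Fin 2), M)) :
    simplexIntegral α σ = S (σ (stdSimplex.vertex 1)) - S (σ (stdSimplex.vertex 0)) :=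
  simplexIntegral_eq (F := S ∘ σ) fun x =>
    ⟨S, Eventually.of_forall hS, Eventually.of_forall fun _ => by simp⟩

/-- Stokes' theorem: the integral of a closed `1`-form over the boundary of a `2`-simplex is `0`. -/
lemma simplexIntegral_boundary [IsManifold I ∞ M] (α : closedForms I M 1)
    (τ : C(stdSimplex ℝ (Fin 3), M)) (σ : Fin 3 → C(stdSimplex ℝ (Fin 2), M))
    (h : ∀ i x, σ i x = τ (stdSimplex.map (Fin.succAbove i) x)) :
    simplexIntegral α (σ 0) - simplexIntegral α (σ 1) + simplexIntegral α (σ 2) = 0 := by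
  obtain ⟨F, hF⟩ := exists_isPrimitiveAlong α τ
  have key : ∀ i, simplexIntegral α (σ i) =
      F (stdSimplex.vertex (i.succAbove 1)) - F (stdSimplex.vertex (i.succAbove 0)) := by
    intro i
    have h1 := hF.comp (τ := stdSimplex.map (S := ℝ) (Fin.succAbove i))
      (stdSimplex.continuous_map _)
    have h2 : (τ ∘ stdSimplex.map (Fin.succAbove i) : stdSimplex ℝ (Fin 2) → M) = σ i :=
      funext fun x => (h i x).symm
    rw [h2] at h1
    rw [simplexIntegral_eq h1]
    simp only [Function.comp_apply, stdSimplex.map_vertex]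
  rw [key, key, key]
  have e1 : (0 : Fin 3).succAbove (1 : Fin 2) = 2 := rfl
  have e2 : (0 : Fin 3).succAbove (0 : Fin 2) = 1 := rfl
  have e3 : (1 : Fin 3).succAbove (1 : Fin 2) = 2 := rfl
  have e4 : (1 : Fin 3).succAbove (0 : Fin 2) = 0 := rfl
  have e5 : (2 : Fin 3).succAbove (1 : Fin 2) = 1 := rfl
  have e6 : (2 : Fin 3).succAbove (0 : Fin 2) = 0 := rfl
  rw [e1, e2, e3, e4, e5, e6]; ring

/-! ### Homology and the pairing with de Rham cohomology -/

open CategoryTheory AlgebraicTopology Simplicial Limits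

variable (M) in
/-- The singular chain complex of `M` with real coefficients. -/
abbrev realChains : ChainComplex (ModuleCat.{u} ℝ) ℕ :=
  (TopCat.toSSet.obj (TopCat.of M)).chainComplex (ModuleCat.of ℝ (ULift.{u} ℝ))

variable (M) in
/-- The first singular homology `H₁(M, ℝ)`. -/
abbrev singularH1 : ModuleCat.{u} ℝ :=
  ((singularHomologyFunctor (ModuleCat.{u} ℝ) 1).obj (ModuleCat.of ℝ (ULift.{u} ℝ))).obj
    (TopCat.of M)

/-- Multiplication by a real number. -/
def mulMap (c : ℝ) : ModuleCat.of ℝ (ULift.{u} ℝ) ⟶ ModuleCat.of ℝ (ULift.{u} ℝ) :=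
  ModuleCat.ofHom (c • LinearMap.id)

lemma mulMap_add (a b : ℝ) : mulMap.{u} (a + b) = mulMap a + mulMap b := by
  ext; simp [mulMap, add_mul]

lemma mulMap_neg (a : ℝ) : mulMap.{u} (-a) = -mulMap a := by
  ext; simp [mulMap]

lemma mulMap_zero : mulMap.{u} 0 = 0 := by
  ext; simp [mulMap]

lemma mulMap_mul (a b : ℝ) : mulMap.{u} (a * b) = a • mulMap b := by
  ext; simp [mulMap, mul_assoc]

/-- The functional on singular `1`-chains given by integration of `α`. -/
def chainIntegral [IsManifold I ∞ M] (α : closedForms I M 1) :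
    (realChains M).X 1 ⟶ ModuleCat.of ℝ (ULift.{u} ℝ) :=
  ((TopCat.toSSet.obj (TopCat.of M)).isColimitChainComplexXCofan _ 1).desc
    (Cofan.mk _ fun σ => mulMap (simplexIntegral α ((TopCat.of M).toSSetObjEquiv _ σ)))

lemma ι_chainIntegral [IsManifold I ∞ M] (α : closedForms I M 1)
    (σ : (TopCat.toSSet.obj (TopCat.of M)) _⦋1⦌) :
    (TopCat.toSSet.obj (TopCat.of M)).ιChainComplex σ ≫ chainIntegral α =
      mulMap (simplexIntegral α ((TopCat.of M).toSSetObjEquiv _ σ)) :=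
  ((TopCat.toSSet.obj (TopCat.of M)).isColimitChainComplexXCofan _ 1).fac _ ⟨σ⟩

lemma d_chainIntegral [IsManifold I ∞ M] (α : closedForms I M 1) :
    (realChains M).d 2 1 ≫ chainIntegral α = 0 := by
  refine SSet.chainComplex_hom_ext fun τ => ?_
  rw [SSet.ιChainComplex_d_assoc, Fin.sum_univ_three]
  simp only [Preadditive.add_comp, Preadditive.zsmul_comp, ι_chainIntegral,
    comp_zero]
  have h := simplexIntegral_boundary α ((TopCat.of M).toSSetObjEquiv _ τ)
    (fun i => (TopCat.of M).toSSetObjEquiv _ ((TopCat.toSSet.obj (TopCat.of M)).δ i τ))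
    (fun i x => rfl)
  simp only [Fin.val_zero, Fin.val_one, Fin.val_two, pow_zero, pow_one, neg_sq, one_pow, one_smul,
    neg_smul, ← mulMap_neg, ← mulMap_add]
  rw [← mulMap_zero, ← h, sub_eq_add_neg]

/-- Integration of `α` over singular homology classes. -/
def homologyIntegral [IsManifold I ∞ M] (α : closedForms I M 1) :
    (realChains M).homology 1 ⟶ ModuleCat.of ℝ (ULift.{u} ℝ) :=
  (realChains M).homologyι 1 ≫
    (realChains M).descOpcycles (chainIntegral α) 2 (by simp) (d_chainIntegral α)

lemma homologyIntegral_add [IsManifold I ∞ M] (α β : closedForms I M 1) :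
    homologyIntegral (α + β) = homologyIntegral α + homologyIntegral β := by
  unfold homologyIntegral
  rw [← Preadditive.comp_add]
  congr 1
  rw [← cancel_epi ((realChains M).pOpcycles 1)]
  simp only [Preadditive.comp_add, HomologicalComplex.p_descOpcycles]
  refine SSet.chainComplex_hom_ext fun τ => ?_
  simp only [Preadditive.comp_add, ι_chainIntegral, simplexIntegral_add, mulMap_add]

lemma homologyIntegral_smul [IsManifold I ∞ M] (c : ℝ) (α : closedForms I M 1) :
    homologyIntegral (c • α) = c • homologyIntegral α := by
  unfold homologyIntegral
  rw [← Linear.comp_smul]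
  congr 1
  rw [← cancel_epi ((realChains M).pOpcycles 1)]
  simp only [Linear.comp_smul, HomologicalComplex.p_descOpcycles]
  refine SSet.chainComplex_hom_ext fun τ => ?_
  simp only [Linear.comp_smul, ι_chainIntegral, simplexIntegral_smul, mulMap_mul]

/-- The integral of an exact form over a homology class vanishes. -/
lemma homologyIntegral_exact [IsManifold I ∞ M] {α : closedForms I M 1} {S : M → ℝ}
    (hS : HasDifferential S α.1) : homologyIntegral α = 0 := by
  let ψ : (realChains M).X 0 ⟶ ModuleCat.of ℝ (ULift.{u} ℝ) :=
    ((TopCat.toSSet.obj (TopCat.of M)).isColimitChainComplexXCofan _ 0).desc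
      (Cofan.mk _ fun σ =>
        mulMap (S ((TopCat.of M).toSSetObjEquiv _ σ (stdSimplex.vertex (0 : Fin 1)))))
  have hψ : ∀ σ, (TopCat.toSSet.obj (TopCat.of M)).ιChainComplex σ ≫ ψ =
      mulMap (S ((TopCat.of M).toSSetObjEquiv _ σ (stdSimplex.vertex (0 : Fin 1)))) := fun σ =>
    ((TopCat.toSSet.obj (TopCat.of M)).isColimitChainComplexXCofan _ 0).fac _ ⟨σ⟩
  have h : chainIntegral α = (realChains M).d 1 0 ≫ ψ := by
    refine SSet.chainComplex_hom_ext fun σ => ?_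
    rw [SSet.ιChainComplex_d_assoc, Fin.sum_univ_two, ι_chainIntegral, simplexIntegral_exact hS]
    simp only [Preadditive.add_comp, Preadditive.zsmul_comp, hψ]
    simp only [Fin.val_zero, Fin.val_one, pow_zero, pow_one, one_smul, neg_smul, ← mulMap_neg,
      ← mulMap_add]
    have e : ∀ i, (TopCat.of M).toSSetObjEquiv _ ((TopCat.toSSet.obj (TopCat.of M)).δ i σ)
        (stdSimplex.vertex (0 : Fin 1)) =
        (TopCat.of M).toSSetObjEquiv _ σ (stdSimplex.vertex (Fin.succAbove i (0 : Fin 1))) := by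
      intro i
      refine congrArg ((TopCat.of M).toSSetObjEquiv _ σ) ?_
      exact stdSimplex.map_vertex (S := ℝ) (Fin.succAbove i) (0 : Fin 1)
    refine congrArg mulMap ?_
    have e0 := congrArg S (e 0)
    have e1 := congrArg S (e 1)
    rw [sub_eq_add_neg]
    exact congrArg₂ (fun a b : ℝ => a + -b) e0.symm e1.symm
  unfold homologyIntegral
  have h2 : (realChains M).descOpcycles (chainIntegral α) 2 (by simp) (d_chainIntegral α) =
      (realChains M).fromOpcycles 1 0 ≫ ψ := by
    rw [← cancel_epi ((realChains M).pOpcycles 1)]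
    simp [h]
  rw [h2, ← Category.assoc, HomologicalComplex.homologyι_comp_fromOpcycles, zero_comp]

/-- The canonical pairing `H₁(M, ℝ) × H¹(M, ℝ) → ℝ`, `⟨[z], [α]⟩ = ∫_z α`. -/
def homologyPairing [IsManifold I ∞ M] : singularH1 M →ₗ[ℝ] deRhamH1 I M →ₗ[ℝ] ℝ :=
  LinearMap.flip <| (exactForms I M).liftQ
    { toFun := fun α => (ULift.moduleEquiv : ULift.{u} ℝ ≃ₗ[ℝ] ℝ).toLinearMap ∘ₗ
        (homologyIntegral α : singularH1 M ⟶ ModuleCat.of ℝ (ULift.{u} ℝ)).hom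
      map_add' := fun α β => by
        rw [homologyIntegral_add]; rfl
      map_smul' := fun c α => by
        rw [homologyIntegral_smul]; rfl } (by
    rintro α ⟨S, hS⟩
    rw [LinearMap.mem_ker]
    show (ULift.moduleEquiv : ULift.{u} ℝ ≃ₗ[ℝ] ℝ).toLinearMap ∘ₗ
      (homologyIntegral α : singularH1 M ⟶ ModuleCat.of ℝ (ULift.{u} ℝ)).hom = 0
    rw [homologyIntegral_exact hS]
    rfl)

/-! ### Symplectic forms, isotopies, actions and rotation vectors -/

/-- `Ω` is a symplectic form: smooth, closed and nondegenerate. -/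
structure IsSymplecticForm (Ω : DiffForm I M 2) : Prop where
  closed : Ω ∈ closedForms I M 2
  nondegenerate : ∀ (x : M) (v : TangentSpace I x), v ≠ 0 →
    ∃ w : TangentSpace I x, Ω x ![v, w] ≠ 0

/-- The pullback `f^* η`. -/
def formPullback {k : ℕ} (f : M → M) (η : DiffForm I M k) : DiffForm I M k :=
  fun x => (η (f x)).compContinuousLinearMap (mfderiv I I f x)

/-- `β` is a (smooth) primitive of the `2`-form `Ω`, i.e. `dβ = Ω`. -/
structure IsPrimitive (β : DiffForm I M 1) (Ω : DiffForm I M 2) : Prop where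
  smooth : IsSmoothForm β
  hasExtDeriv : HasExtDeriv β Ω

/-- Two primitives of the same `2`-form differ by a closed form. -/
lemma IsPrimitive.sub_mem_closedForms {β β' : DiffForm I M 1} {Ω : DiffForm I M 2}
    (h' : IsPrimitive β' Ω) (h : IsPrimitive β Ω) : β' - β ∈ closedForms I M 1 := by
  have e : β' - β = β' + (-1 : ℝ) • β := by rw [neg_one_smul, sub_eq_add_neg]
  rw [e]
  refine ⟨h'.smooth.add (h.smooth.smul _), ?_⟩
  have := h'.hasExtDeriv.add (h.hasExtDeriv.smul (-1)) h'.smooth (h.smooth.smul _)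
  have e0 : Ω + (-1 : ℝ) • Ω = 0 := by rw [neg_one_smul, add_neg_cancel]
  rwa [e0] at this

/-- `F` is a smooth isotopy, through diffeomorphisms, from the identity to `f`. -/
structure IsIsotopyFromId (F : ℝ → M → M) (f : M ≃ₘ^∞⟮I, I⟯ M) : Prop where
  smooth : ContMDiffOn (𝓘(ℝ, ℝ).prod I) I ∞ (fun p : ℝ × M => F p.1 p.2)
    (Icc (0 : ℝ) 1 ×ˢ (univ : Set M))
  diffeo : ∀ t ∈ Icc (0 : ℝ) 1, ∃ h : M ≃ₘ^∞⟮I, I⟯ M, F t = h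
  zero : F 0 = id
  one : F 1 = f

/-- The integral `∫_γ α = ∫₀¹ α(γ'(t)) dt` of a `1`-form over a smooth curve `γ : [0, 1] → M`. -/
def formIntegral (α : DiffForm I M 1) (γ : ℝ → M) : ℝ :=
  ∫ t in (0 : ℝ)..1, α.toDual (γ t) (mfderivWithin 𝓘(ℝ, ℝ) I γ (Icc 0 1) t (1 : ℝ))

/-- `g` is an action function of `f` with respect to `β`, i.e. `dg = f^* β - β`. -/
def IsActionFunction (f : M → M) (β : DiffForm I M 1) (g : M → ℝ) : Prop :=
  HasDifferential g (formPullback f β - β)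

/-- `ρ ∈ H₁(M, ℝ)` is the rotation vector of `μ` with respect to the isotopy `F`:
for every closed `1`-form `α`, `⟨ρ, [α]⟩ = ∫ (∫_{γ(t, x), t ∈ [0, 1]} α) dμ(x)`, where
`γ(t, x) = F t x`. -/
def IsRotationVector [IsManifold I ∞ M] [MeasurableSpace M] (F : ℝ → M → M) (μ : Measure M)
    (ρ : singularH1 M) : Prop :=
  ∀ α : closedForms I M 1,
    Integrable (fun x => formIntegral α.1 (fun t => F t x)) μ ∧
    homologyPairing ρ (Submodule.Quotient.mk α : deRhamH1 I M) =
      ∫ x, formIntegral α.1 (fun t => F t x) ∂μ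

end ExactSymplectic

end

open ExactSymplectic

namespace ExactSymplectic

section IsotopyIntegral

variable {E : Type*} [NormedAddCommGroup E] [NormedSpace ℝ E]
  {H : Type*} [TopologicalSpace H] {I : ModelWithCorners ℝ E H}
  {M : Type*} [TopologicalSpace M] [ChartedSpace H M]

/-- A local primitive read in a chart has the coordinate expression of the form as derivative. -/
lemma hasFDerivWithinAt_primitive_symm [IsManifold I ∞ M] {α : DiffForm I M 1} {S : M → ℝ}
    {p : M} {y : E} (hy : y ∈ (extChartAt I p).target)
    (hS : HasMFDerivAt I 𝓘(ℝ, ℝ) S ((extChartAt I p).symm y)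
      (α.toDual ((extChartAt I p).symm y))) :
    HasFDerivWithinAt (S ∘ (extChartAt I p).symm)
      ((ContinuousAlternatingMap.ofSubsingletonLIE (𝕜 := ℝ) (E := E) (F := ℝ) (0 : Fin 1)).symm
        (chartRep α p y)) (range I) y := by
  have : IsManifold I 1 M := IsManifold.of_le (n := ∞) (by simp)
  have h := (mdifferentiableWithinAt_extChartAt_symm (I := I) hy).hasMFDerivWithinAt
  exact hasMFDerivWithinAt_iff_hasFDerivWithinAt.1 (hS.comp_hasMFDerivWithinAt y h)

/-- The fundamental theorem of calculus along a curve that stays in a chart domain on which the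
form has a primitive. -/
lemma formIntegral_primitive [IsManifold I ∞ M] {α : DiffForm I M 1} (hα : IsSmoothForm α)
    {S : M → ℝ} {p : M} {γ : ℝ → M} (hγ : ContMDiffOn 𝓘(ℝ, ℝ) I ∞ γ (Icc 0 1))
    {a b : ℝ} (ha : a ∈ Icc (0 : ℝ) 1) (hb : b ∈ Icc (0 : ℝ) 1)
    (hp : ∀ t ∈ uIcc a b, γ t ∈ (extChartAt I p).source)
    (hS : ∀ t ∈ uIcc a b, HasMFDerivAt I 𝓘(ℝ, ℝ) S (γ t) (α.toDual (γ t))) :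
    IntervalIntegrable
      (fun t => α.toDual (γ t) (mfderivWithin 𝓘(ℝ, ℝ) I γ (Icc 0 1) t (1 : ℝ))) volume a b ∧
    ∫ t in a..b, α.toDual (γ t) (mfderivWithin 𝓘(ℝ, ℝ) I γ (Icc 0 1) t (1 : ℝ)) =
      S (γ b) - S (γ a) := by
  have hab : uIcc a b ⊆ Icc 0 1 := uIcc_subset_Icc ha hb
  set L := (ContinuousAlternatingMap.ofSubsingletonLIE (𝕜 := ℝ) (E := E) (F := ℝ)
    (0 : Fin 1)).symm with hL
  set c : ℝ → E := fun t => extChartAt I p (γ t) with hc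
  have hud : UniqueDiffOn ℝ (Icc (0 : ℝ) 1) := uniqueDiffOn_Icc zero_lt_one
  have hcs : ∀ t ∈ uIcc a b, ContDiffWithinAt ℝ ∞ c (Icc 0 1) t := fun t ht =>
    contMDiffWithinAt_iff_contDiffWithinAt.1
      ((contMDiffAt_extChartAt' (by simpa [extChartAt_source] using hp t ht)).comp_contMDiffWithinAt
        t (hγ t (hab ht)))
  have hder : ∀ t ∈ uIcc a b, HasDerivWithinAt (fun s => S (γ s))
      (α.toDual (γ t) (mfderivWithin 𝓘(ℝ, ℝ) I γ (Icc 0 1) t (1 : ℝ))) (Icc 0 1) t := by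
    intro t ht
    have h1 := ((hγ t (hab ht)).mdifferentiableWithinAt (by simp)).hasMFDerivWithinAt
    have h2 : HasFDerivWithinAt (fun s => S (γ s))
        ((α.toDual (γ t)).comp (mfderivWithin 𝓘(ℝ, ℝ) I γ (Icc 0 1) t) : ℝ →L[ℝ] ℝ) (Icc 0 1) t :=
      hasMFDerivWithinAt_iff_hasFDerivWithinAt.1 ((hS t ht).comp_hasMFDerivWithinAt t h1)
    exact h2.hasDerivWithinAt
  have heq : ∀ t ∈ uIcc a b,
      α.toDual (γ t) (mfderivWithin 𝓘(ℝ, ℝ) I γ (Icc 0 1) t (1 : ℝ)) =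
        L (chartRep α p (c t)) (fderivWithin ℝ c (Icc 0 1) t 1) := by
    intro t ht
    have hinv := (extChartAt I p).left_inv (hp t ht)
    have h1 := hasFDerivWithinAt_primitive_symm (I := I) (α := α) (S := S)
      ((extChartAt I p).map_source (hp t ht)) (by rw [hinv]; exact hS t ht)
    have h2 := h1.comp_hasDerivWithinAt (t := range I) t
      ((hcs t ht).differentiableWithinAt (by simp)).hasFDerivWithinAt.hasDerivWithinAt
      (fun s _ => by simp [hc, extChartAt])
    refine (hud t (hab ht)).eq_deriv _ (hder t ht) (h2.congr_of_eventuallyEq ?_ ?_)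
    · filter_upwards [(hγ t (hab ht)).continuousWithinAt
        (extChartAt_source_mem_nhds' (hp t ht))] with s hs
      exact congrArg S ((extChartAt I p).left_inv hs).symm
    · exact congrArg S hinv.symm
  have hint : IntervalIntegrable
      (fun t => α.toDual (γ t) (mfderivWithin 𝓘(ℝ, ℝ) I γ (Icc 0 1) t (1 : ℝ))) volume a b := by
    refine ContinuousOn.intervalIntegrable (ContinuousOn.congr ?_ heq)
    have hcc : ContinuousOn c (uIcc a b) := fun t ht =>
      (hcs t ht).continuousWithinAt.mono hab
    refine ContinuousOn.clm_apply (L.continuous.comp_continuousOn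
      ((hα p).continuousOn.comp hcc fun t ht => (extChartAt I p).map_source (hp t ht)))
      (ContinuousOn.clm_apply (fun t ht => ?_) continuousOn_const)
    exact ((hcs t ht).fderivWithin_right (m := 0) hud (by simp)
      (hab ht)).continuousWithinAt.mono hab
  refine ⟨hint, intervalIntegral.integral_eq_sub_of_hasDeriv_right
    (fun t ht => (hder t ht).continuousWithinAt.mono hab) (fun t ht => ?_) hint⟩
  have ht' : t ∈ uIcc a b := ⟨ht.1.le, ht.2.le⟩
  refine (hder t ht').mono_of_mem_nhdsWithin (mem_nhdsWithin_of_mem_nhds (Icc_mem_nhds ?_ ?_))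
  · exact (le_min ha.1 hb.1).trans_lt ht.1
  · exact ht.2.trans_le (max_le ha.2 hb.2)

lemma IsIsotopyFromId.contMDiffOn_curve [IsManifold I ∞ M] {F : ℝ → M → M} {f : M ≃ₘ^∞⟮I, I⟯ M}
    (hF : IsIsotopyFromId F f) (x : M) :
    ContMDiffOn 𝓘(ℝ, ℝ) I ∞ (fun t => F t x) (Icc 0 1) :=
  hF.smooth.comp (contMDiffOn_id.prodMk contMDiffOn_const) fun _ ht => ⟨ht, mem_univ _⟩

lemma IsIsotopyFromId.mdifferentiableAt {F : ℝ → M → M} {f : M ≃ₘ^∞⟮I, I⟯ M}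
    (hF : IsIsotopyFromId F f) {t : ℝ} (ht : t ∈ Icc (0 : ℝ) 1) (x : M) :
    MDifferentiableAt I I (F t) x := by
  obtain ⟨h, e⟩ := hF.diffeo t ht
  rw [e]
  exact h.contMDiff.mdifferentiable (by simp) x

lemma hasMFDerivAt_comp_formPullback {α : DiffForm I M 1} {S : M → ℝ} {φ : M → M} {x : M}
    (hφ : MDifferentiableAt I I φ x)
    (hS : HasMFDerivAt I 𝓘(ℝ, ℝ) S (φ x) (α.toDual (φ x))) :
    HasMFDerivAt I 𝓘(ℝ, ℝ) (S ∘ φ) x ((formPullback φ α).toDual x) :=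
  hS.comp x hφ.hasMFDerivAt

/-- The differential of the integral of a closed form over the trajectories of an isotopy between
two times. -/
lemma IsIsotopyFromId.eventually_hasMFDerivAt_integral [IsManifold I ∞ M] {F : ℝ → M → M}
    {f : M ≃ₘ^∞⟮I, I⟯ M} (hF : IsIsotopyFromId F f) {α : DiffForm I M 1}
    (hα : α ∈ closedForms I M 1) (x : M) {a b : ℝ} (ha : a ∈ Icc (0 : ℝ) 1)
    (hb : b ∈ Icc (0 : ℝ) 1) :
    ∀ᶠ y in 𝓝 x,
      IntervalIntegrable (fun t => α.toDual (F t y)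
        (mfderivWithin 𝓘(ℝ, ℝ) I (fun t => F t y) (Icc 0 1) t (1 : ℝ))) volume a b ∧
      HasMFDerivAt I 𝓘(ℝ, ℝ) (fun y => ∫ t in a..b, α.toDual (F t y)
        (mfderivWithin 𝓘(ℝ, ℝ) I (fun t => F t y) (Icc 0 1) t (1 : ℝ))) y
        ((formPullback (F b) α - formPullback (F a) α).toDual y) := by
  refine isPreconnected_Icc.induction₂ (fun a b => ∀ᶠ y in 𝓝 x,
      IntervalIntegrable (fun t => α.toDual (F t y)
        (mfderivWithin 𝓘(ℝ, ℝ) I (fun t => F t y) (Icc 0 1) t (1 : ℝ))) volume a b ∧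
      HasMFDerivAt I 𝓘(ℝ, ℝ) (fun y => ∫ t in a..b, α.toDual (F t y)
        (mfderivWithin 𝓘(ℝ, ℝ) I (fun t => F t y) (Icc 0 1) t (1 : ℝ))) y
        ((formPullback (F b) α - formPullback (F a) α).toDual y)) ?_ ?_ ?_ ha hb
  · intro a ha
    obtain ⟨S, hS⟩ := exists_local_primitive hα (F a x)
    have hcont : Tendsto (fun q : ℝ × M => F q.1 q.2) (𝓝[Icc 0 1] a ×ˢ 𝓝 x) (𝓝 (F a x)) := by
      have := (hF.smooth (a, x) ⟨ha, mem_univ _⟩).continuousWithinAt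
      rwa [ContinuousWithinAt, nhdsWithin_prod_eq, nhdsWithin_univ] at this
    obtain ⟨P, hP, Q, hQ, hPQ⟩ := eventually_prod_iff.1 (hcont.eventually
      (hS.and (extChartAt_source_mem_nhds (I := I) (F a x))))
    obtain ⟨r, hr, hrP⟩ := Metric.mem_nhdsWithin_iff.1 hP
    filter_upwards [self_mem_nhdsWithin, mem_nhdsWithin_of_mem_nhds (Metric.ball_mem_nhds a hr)]
      with b hb hbr
    have hP' : ∀ t ∈ uIcc a b, P t := fun t ht =>
      hrP ⟨((convex_ball a r).ordConnected.uIcc_subset (Metric.mem_ball_self hr) hbr) ht,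
        uIcc_subset_Icc ha hb ht⟩
    have key := fun y (hy : Q y) => formIntegral_primitive hα.1 (p := F a x)
      (hF.contMDiffOn_curve y) ha hb (fun t ht => (hPQ (hP' t ht) hy).2)
      (fun t ht => (hPQ (hP' t ht) hy).1)
    filter_upwards [hQ.eventually_nhds] with y hy
    have hy0 := hy.self_of_nhds
    refine ⟨(key y hy0).1, ?_⟩
    have h1 := hasMFDerivAt_comp_formPullback (hF.mdifferentiableAt hb y)
      (hPQ (hP' b right_mem_uIcc) hy0).1
    have h2 := hasMFDerivAt_comp_formPullback (hF.mdifferentiableAt ha y)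
      (hPQ (hP' a left_mem_uIcc) hy0).1
    exact (h1.sub h2).congr_of_eventuallyEq (hy.mono fun z hz => (key z hz).2)
  · intro a b c _ _ _ h1 h2
    filter_upwards [h1.eventually_nhds, h2.eventually_nhds] with y h1 h2
    obtain ⟨i1, d1⟩ := h1.self_of_nhds
    obtain ⟨i2, d2⟩ := h2.self_of_nhds
    refine ⟨i1.trans i2, ?_⟩
    have e : formPullback (F c) α - formPullback (F a) α =
      (formPullback (F b) α - formPullback (F a) α) +
        (formPullback (F c) α - formPullback (F b) α) := by abel
    rw [e]
    refine (d1.add d2).congr_of_eventuallyEq ?_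
    filter_upwards [h1, h2] with z h1 h2
    exact (intervalIntegral.integral_add_adjacent_intervals h1.1 h2.1).symm
  · intro a b _ _ h
    filter_upwards [h] with y h
    refine ⟨h.1.symm, ?_⟩
    have e : formPullback (F a) α - formPullback (F b) α =
      -(formPullback (F b) α - formPullback (F a) α) := by abel
    rw [e]
    exact h.2.neg.congr_of_eventuallyEq
      (Eventually.of_forall fun z => intervalIntegral.integral_symm _ _)

lemma formPullback_id {k : ℕ} (η : DiffForm I M k) : formPullback id η = η := by
  funext x
  ext v
  have : mfderiv I I (id : M → M) x = ContinuousLinearMap.id ℝ (TangentSpace I x) := mfderiv_id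
  simp only [formPullback, this]
  rfl

/-- The integral of a closed form `α` over the trajectories of an isotopy from the identity to `f`
has differential `f^* α - α`. -/
lemma IsIsotopyFromId.hasDifferential_formIntegral [IsManifold I ∞ M] {F : ℝ → M → M}
    {f : M ≃ₘ^∞⟮I, I⟯ M} (hF : IsIsotopyFromId F f) {α : DiffForm I M 1}
    (hα : α ∈ closedForms I M 1) :
    HasDifferential (fun x => formIntegral α (fun t => F t x)) (formPullback f α - α) := by
  intro x
  have h := (hF.eventually_hasMFDerivAt_integral hα x (left_mem_Icc.2 zero_le_one)
    (right_mem_Icc.2 zero_le_one)).self_of_nhds.2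
  rwa [hF.zero, hF.one, formPullback_id] at h

/-- Two functions with the same differential on a connected manifold differ by a constant. -/
lemma HasDifferential.exists_eq_add_const [IsManifold I ∞ M] [ConnectedSpace M]
    {α : DiffForm I M 1} {S T : M → ℝ} (hS : HasDifferential S α) (hT : HasDifferential T α) :
    ∃ c : ℝ, ∀ x, S x = T x + c := by
  have h : IsLocallyConstant (fun x => S x - T x) :=
    (IsLocallyConstant.iff_eventually_eq _).2 fun x =>
      eventually_sub_eq_of_hasMFDerivAt (Eventually.of_forall hS) (Eventually.of_forall hT)
  obtain ⟨x₀⟩ : Nonempty M := inferInstance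
  refine ⟨S x₀ - T x₀, fun x => ?_⟩
  have := h.apply_eq_of_preconnectedSpace x x₀
  linarith

lemma formPullback_sub (f : M → M) {k : ℕ} (η θ : DiffForm I M k) :
    formPullback f (η - θ) = formPullback f η - formPullback f θ := rfl

/-- Action functions with respect to two primitives differ, up to a constant, by the integral of
the difference of the primitives over the trajectories of the isotopy. -/
lemma IsActionFunction.exists_eq_add_formIntegral [IsManifold I ∞ M] [ConnectedSpace M]
    {F : ℝ → M → M} {f : M ≃ₘ^∞⟮I, I⟯ M} (hF : IsIsotopyFromId F f) {β β' : DiffForm I M 1}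
    (hα : β' - β ∈ closedForms I M 1) {g g' : M → ℝ} (hg : IsActionFunction f β g)
    (hg' : IsActionFunction f β' g') :
    ∃ c : ℝ, ∀ x, g' x = g x + formIntegral (β' - β) (fun t => F t x) + c := by
  have e : (formPullback f β' - β') =
      (formPullback f β - β) + (formPullback f (β' - β) - (β' - β)) := by
    rw [formPullback_sub]; abel
  refine HasDifferential.exists_eq_add_const hg' (T := fun x => g x + formIntegral (β' - β) _) ?_
  rw [e]
  exact fun x => (hg x).add (hF.hasDifferential_formIntegral hα x)

/-- The action of a measure with respect to a second primitive. -/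
lemma IsRotationVector.integrable_and_integral_eq [IsManifold I ∞ M] [MeasurableSpace M]
    {F : ℝ → M → M} {μ : Measure M} [IsProbabilityMeasure μ] {ρ : singularH1 M}
    (hρ : IsRotationVector (I := I) F μ ρ) (α : closedForms I M 1) {g g' : M → ℝ} {c : ℝ}
    (h : ∀ x, g' x = g x + formIntegral α.1 (fun t => F t x) + c) (hg : Integrable g μ) :
    Integrable g' μ ∧ ∫ x, g' x ∂μ =
      ∫ x, g x ∂μ + homologyPairing ρ (Submodule.Quotient.mk α : deRhamH1 I M) + c := by
  obtain ⟨hi, he⟩ := hρ α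
  have e : g' = fun x => g x + formIntegral α.1 (fun t => F t x) + c := funext h
  subst e
  have hgi : Integrable (fun x => g x + formIntegral α.1 (fun t => F t x)) μ := hg.add hi
  refine ⟨hgi.add (integrable_const c), ?_⟩
  beta_reduce
  rw [integral_add hgi (integrable_const c), integral_add hg hi, he]
  simp

end IsotopyIntegral

end ExactSymplectic

theorem mainTheorem2
    {E : Type*} [NormedAddCommGroup E] [NormedSpace ℝ E] [FiniteDimensional ℝ E]
    {H : Type*} [TopologicalSpace H] (I : ModelWithCorners ℝ E H)
    {M : Type*} [TopologicalSpace M] [ChartedSpace H M] [IsManifold I ∞ M] [ConnectedSpace M]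
    [MeasurableSpace M] [BorelSpace M]
    (Ω : DiffForm I M 2) (hΩ : IsSymplecticForm Ω)
    (f : M ≃ₘ^∞⟮I, I⟯ M) (hf : formPullback f Ω = Ω)
    (F : ℝ → M → M) (hF : IsIsotopyFromId F f)
    (μ₁ μ₂ : Measure M) [IsProbabilityMeasure μ₁] [IsProbabilityMeasure μ₂]
    (hμ₁ : MeasurePreserving f μ₁ μ₁) (hμ₂ : MeasurePreserving f μ₂ μ₂)
    (ρ₁ ρ₂ : singularH1 M)
    (hρ₁ : IsRotationVector (I := I) F μ₁ ρ₁) (hρ₂ : IsRotationVector (I := I) F μ₂ ρ₂) :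
    (∀ (β β' : DiffForm I M 1) (hβ : IsPrimitive β Ω) (hβ' : IsPrimitive β' Ω) (g g' : M → ℝ),
      IsActionFunction f β g → IsActionFunction f β' g' →
      Integrable g μ₁ → Integrable g μ₂ →
      Integrable g' μ₁ ∧ Integrable g' μ₂ ∧
      (∫ x, g' x ∂μ₁) - (∫ x, g' x ∂μ₂) = (∫ x, g x ∂μ₁) - (∫ x, g x ∂μ₂) +
        homologyPairing (ρ₁ - ρ₂)
          (Submodule.Quotient.mk ⟨β' - β, hβ'.sub_mem_closedForms hβ⟩ : deRhamH1 I M)) ∧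
    (ρ₁ = ρ₂ →
      ∀ (β β' : DiffForm I M 1), IsPrimitive β Ω → IsPrimitive β' Ω → ∀ (g g' : M → ℝ),
      IsActionFunction f β g → IsActionFunction f β' g' →
      Integrable g μ₁ → Integrable g μ₂ →
      (∫ x, g' x ∂μ₁) - (∫ x, g' x ∂μ₂) = (∫ x, g x ∂μ₁) - (∫ x, g x ∂μ₂)) := by
  have key : ∀ (β β' : DiffForm I M 1) (hβ : IsPrimitive β Ω) (hβ' : IsPrimitive β' Ω)
      (g g' : M → ℝ), IsActionFunction f β g → IsActionFunction f β' g' →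
      Integrable g μ₁ → Integrable g μ₂ →
      Integrable g' μ₁ ∧ Integrable g' μ₂ ∧
      (∫ x, g' x ∂μ₁) - (∫ x, g' x ∂μ₂) = (∫ x, g x ∂μ₁) - (∫ x, g x ∂μ₂) +
        homologyPairing (ρ₁ - ρ₂)
          (Submodule.Quotient.mk ⟨β' - β, hβ'.sub_mem_closedForms hβ⟩ : deRhamH1 I M) := by
    intro β β' hβ hβ' g g' hg hg' h₁ h₂
    obtain ⟨c, hc⟩ := hg.exists_eq_add_formIntegral hF (hβ'.sub_mem_closedForms hβ) hg'
    obtain ⟨i₁, e₁⟩ := hρ₁.integrable_and_integral_eq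
      ⟨β' - β, hβ'.sub_mem_closedForms hβ⟩ hc h₁
    obtain ⟨i₂, e₂⟩ := hρ₂.integrable_and_integral_eq
      ⟨β' - β, hβ'.sub_mem_closedForms hβ⟩ hc h₂
    refine ⟨i₁, i₂, ?_⟩
    rw [e₁, e₂, map_sub, LinearMap.sub_apply]
    ring
  refine ⟨key, fun hρ β β' hβ hβ' g g' hg hg' h₁ h₂ => ?_⟩
  have h := (key β β' hβ hβ' g g' hg hg' h₁ h₂).2.2
  rwa [hρ, sub_self, map_zero, LinearMap.zero_apply, add_zero] at h
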